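/- Let $\mathrm{Conf}(\mathbb R)$ be the set of locally finite configurations on $\mathbb R$, that is, of measures $\xi=\sum_i\delta_{x_i}$ ($x_i\in\mathbb R$ a countable family, repetitions allowed) with $\xi(\Delta)<\infty$ for every bounded Borel set $\Delta$. Equip it with the vague topology, the weakest topology for which $\xi\mapsto\int f\,\mathrm d\xi$ is continuous for every continuous compactly supported $f:\mathbb R\to\mathbb R$, and with its Borel $\sigma$-algebra. A point process on $\mathbb R$ is a measurable map from a probability space to $\mathrm{Conf}(\mathbb R)$. A Poisson point process with intensity $\nu$, where $\nu$ is a (positive) Radon measure on $\mathbb R$, is a point process $\mathcal P_\nu$ such that for every bounded Borel set $\Delta$ the variable $\mathcal P_\nu(\Delta)$ has the Poisson distribution with mean $\nu(\Delta)$, and for any finitely many pairwise disjoint bounded Borel sets $\Delta_1,\dots,\Delta_k$ the variables $\mathcal P_\nu(\Delta_1),\dots,\mathcal P_\nu(\Delta_k)$ are independent. **Corollary (Convergence towards a PPP).** For each real $R>0$, let $(X_n^{(R)})_{n\in\mathbb N}$ be a sequence of independent real-valued random variables (on a probability space that may depend on $R$). Suppose that for every compact $K\subset\mathbb R$, $$\sup_{n\ge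 0}\mathbb P\big(X_n^{(R)}\in K\big)\xrightarrow[R\to+\infty]{}0,$$ and that there is a positive Radon measure $\nu$ on $\mathbb R$ such that $$\sum_{n=0}^\infty\mathbb E\big[f(X_n^{(R)})\big]\xrightarrow[R\to+\infty]{}\int_{\mathbb R}f\,\mathrm d\nu$$ for every measurable compactly supported function $f:\mathbb R\to[0,1)$ (the sums being taken in $[0,+\infty]$). Suppose moreover that for each $R>0$ the family $\mathcal X^{(R)}=\{X_n^{(R)}:n\in\mathbb N\}$, counted with multiplicity, is a point process on $\mathbb R$, i.e. $\mathcal X^{(R)}$ is a point process which almost surely equals $\sum_{n}\delta_{X_n^{(R)}}$. Then a Poisson point process $\mathcal P_\nu$ with intensity $\nu$ exists, and $$\mathcal X^{(R)}\xrightarrow[R\to+\infty]{\mathrm{law}}\mathcal P_\nu,$$ that is, the laws of $\mathcal X^{(R)}$ converge weakly, as Borel probability measures on $\mathrm{Conf}(\mathbb R)$, to the law of $\mathcal P_\nu$. -/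

import Mathlib

open MeasureTheory ProbabilityTheory Filter Topology
open scoped ENNReal NNReal CompactlySupported

/-- Locally finite configurations on `X`: counting measures `∑ i, δ_{x i}` of countable families
of points (repetitions allowed) that give finite mass to every pre-compact Borel set. -/
structure Conf (X : Type*) [TopologicalSpace X] [MeasurableSpace X] where
  /-- The underlying measure. -/
  toMeasure : Measure X
  isCounting : ∃ (ι : Type) (_ : Countable ι) (x : ι → X),
    toMeasure = Measure.sum fun i => Measure.dirac (x i)
  locallyFinite : ∀ Δ : Set X, MeasurableSet Δ → IsCompact (closure Δ) → toMeasure Δ < ∞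

/-- The vague topology: the weakest topology that makes `ξ ↦ ∫ f dξ` continuous for every
compactly supported continuous function `f`. -/
noncomputable instance Conf.instTopologicalSpace (X : Type*) [TopologicalSpace X] [MeasurableSpace X] :
    TopologicalSpace (Conf X) :=
  ⨅ f : C_c(X, ℝ),
    TopologicalSpace.induced (fun ξ : Conf X => ∫ x, f x ∂ξ.toMeasure) inferInstance

/-- The Borel σ-algebra of the vague topology. -/
noncomputable instance Conf.instMeasurableSpace (X : Type*) [TopologicalSpace X] [MeasurableSpace X] :
    MeasurableSpace (Conf X) :=
  borel (Conf X)

instance Conf.instBorelSpace (X : Type*) [TopologicalSpace X] [MeasurableSpace X] :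
    BorelSpace (Conf X) :=
  ⟨rfl⟩

/-- `P` is the law of a Poisson point process with intensity `ν`: the number of points in a
pre-compact Borel set `Δ` is a Poisson variable of mean `ν Δ`, and the numbers of points in finitely
many pairwise disjoint such sets are independent. -/
structure IsPoissonLaw {X : Type*} [TopologicalSpace X] [MeasurableSpace X]
    (ν : Measure X) (P : Measure (Conf X)) : Prop where
  count : ∀ Δ : Set X, MeasurableSet Δ → IsCompact (closure Δ) → ∀ n : ℕ,
    P {ξ | ξ.toMeasure Δ = n} = poissonMeasure (ν Δ).toNNReal {n}
  indep : ∀ (k : ℕ) (Δ : Fin k → Set X),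
    (∀ i, MeasurableSet (Δ i)) → (∀ i, IsCompact (closure (Δ i))) →
    Pairwise (fun i j => Disjoint (Δ i) (Δ j)) →
    iIndepFun (fun i (ξ : Conf X) => ξ.toMeasure (Δ i)) P

/-- `𝒳` is a point process, i.e. a measurable map into the space of configurations, formed by the
points `Y 0, Y 1, …` counted with multiplicity. -/
structure IsPointProcessOf {X Ω : Type*} [TopologicalSpace X] [MeasurableSpace X]
    [MeasurableSpace Ω] (𝒳 : Ω → Conf X) (Y : ℕ → Ω → X) (μ : Measure Ω) : Prop where
  measurable : Measurable 𝒳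
  ae_eq : ∀ᵐ ω ∂μ, (𝒳 ω).toMeasure = Measure.sum fun n => Measure.dirac (Y n ω)

/-! A random configuration is studied through its characteristic functional `f ↦ E[exp(i ∫ f dξ)]`,
which for a Poisson process is `exp ∫ (e^{if} - 1) dν`. For independent points it is the infinite
product of the factors `1 + z n`, where `z n = E[e^{i f(X n)}] - 1` has norm at most `2 p n`, with
`p n = P(X n ∈ supp f)`. Replacing every `1 + z n` by `exp (z n)` costs in total at most `4 (sup p)
(∑ p)` (`norm_charFunctional_sub_le`). The supremum tends to zero, the sum converges to `ν (supp
f)`, and `∑ z n` is the integral of `e^{if} - 1` against the intensity of the process, which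
converges to its integral against `ν`.

Two facts turn this into the theorem. The vague topology is induced by countably many test
integrals, so every open set is an increasing union of finite-dimensional open cylinders; Lévy's
theorem and the portmanteau criterion then give convergence in law
(`tendsto_of_tendsto_charFunctional`). No tightness argument is needed, because the limit is already
a law on `Conf ℝ`. A Poisson law exists (`exists_isPoissonLaw`): independently in each annulus, draw
a Poisson number of independent points. The functional of this process on step functions has the
Poisson form, which forces Poisson counts and their independence
(`isPoissonLaw_of_charFunctional_step`). -/

namespace Conf

/-! ### The vague topology and measurability of counts. -/

instance isFiniteMeasureOnCompacts (ξ : Conf ℝ) : IsFiniteMeasureOnCompacts ξ.toMeasure where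
  lt_top_of_isCompact K hK :=
    ξ.locallyFinite K hK.measurableSet (by rwa [hK.isClosed.closure_eq])

/-- A configuration gives an integer mass to every bounded Borel set. -/
lemma exists_nat_eq (ξ : Conf ℝ) {Δ : Set ℝ} (hΔ : MeasurableSet Δ)
    (hΔc : IsCompact (closure Δ)) : ∃ n : ℕ, ξ.toMeasure Δ = n := by
  obtain ⟨ι, _, x, hx⟩ := ξ.isCounting
  have h : ξ.toMeasure Δ = ((x ⁻¹' Δ).encard : ℝ≥0∞) := by
    rw [hx, Measure.sum_apply _ hΔ, ← ENNReal.tsum_set_one, tsum_subtype (x ⁻¹' Δ) fun _ => 1]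
    refine tsum_congr fun i => ?_
    rw [Measure.dirac_apply' _ hΔ]
    rfl
  have hfin := ξ.locallyFinite Δ hΔ hΔc
  have hf : (x ⁻¹' Δ).encard ≠ ⊤ := by
    intro htop
    rw [h, htop] at hfin
    simp at hfin
  refine ⟨(x ⁻¹' Δ).ncard, ?_⟩
  rw [h, ← (Set.encard_ne_top_iff.1 hf).cast_ncard_eq]
  rfl

lemma continuous_integral (f : C_c(ℝ, ℝ)) :
    Continuous fun ξ : Conf ℝ => ∫ x, f x ∂ξ.toMeasure :=
  continuous_iInf_dom (i := f) continuous_induced_dom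

/-- A cutoff function equal to one on `[-n, n]`. -/
lemma exists_cutoff (n : ℕ) : ∃ g : C_c(ℝ, ℝ), (∀ x ∈ Metric.closedBall (0 : ℝ) n, g x = 1) ∧
    ∀ x, 0 ≤ g x := by
  obtain ⟨g, h1, -, hc, h01⟩ := exists_continuous_one_zero_of_isCompact
    (isCompact_closedBall (0 : ℝ) n) isClosed_empty (Set.disjoint_empty _)
  exact ⟨⟨g, hc⟩, fun x hx => h1 hx, fun x => (h01 x).1⟩

/-- The error is weighted by a test function because no uniform bound on the mass of `ξ` is
available, whereas the integral of `g` is controlled near any given configuration. -/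
lemma abs_integral_sub_le (ξ : Conf ℝ) (f d g : C_c(ℝ, ℝ)) {ε : ℝ}
    (h : ∀ x, |f x - d x| ≤ ε * g x) :
    |∫ x, f x ∂ξ.toMeasure - ∫ x, d x ∂ξ.toMeasure| ≤ ε * ∫ x, g x ∂ξ.toMeasure := by
  rw [← integral_sub f.integrable d.integrable, ← integral_const_mul]
  rw [← Real.norm_eq_abs]
  exact norm_integral_le_of_norm_le (g.integrable.const_mul ε) (ae_of_all _ h)

/-- Compactly supported functions can be approximated from a countable family, in a way that is
compatible with the vague topology. -/
lemma exists_countable_approx : ∃ d : ℕ → C_c(ℝ, ℝ), ∀ f : C_c(ℝ, ℝ), ∃ m, (∀ x, 0 ≤ d m x) ∧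
    ∀ ε > 0, ∃ j, ∀ x, |f x - d j x| ≤ ε * d m x := by
  choose g hg1 hg0 using exists_cutoff
  obtain ⟨h, hh⟩ := TopologicalSpace.exists_dense_seq C(ℝ, ℝ)
  -- The index `none` keeps the bare cutoff in the family, where it serves as the weight; `some j`
  -- truncates the `j`-th function of a dense sequence.
  let D : ℕ × Option ℕ → C_c(ℝ, ℝ) := fun p => match p.2 with
    | none => g p.1
    | some j => ⟨h j * (g p.1 : C(ℝ, ℝ)), (g p.1).hasCompactSupport.mul_left⟩
  let e : ℕ ≃ ℕ × Option ℕ := (Denumerable.eqv (ℕ × Option ℕ)).symm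
  refine ⟨D ∘ e, fun f => ?_⟩
  obtain ⟨r, hr⟩ := f.hasCompactSupport.isCompact.isBounded.subset_closedBall 0
  obtain ⟨n, hn⟩ := exists_nat_ge r
  refine ⟨e.symm (n, none), fun x => by simpa [D] using hg0 n x, fun ε hε => ?_⟩
  let U : Set C(ℝ, ℝ) := {k | ∀ x ∈ tsupport (g n), |f x - k x| < ε}
  have hU : U ∈ 𝓝 (f : C(ℝ, ℝ)) := by
    have := (ContinuousMap.tendsto_iff_forall_isCompact_tendstoUniformlyOn.1
      (tendsto_id (x := 𝓝 (f : C(ℝ, ℝ))))) _ (g n).hasCompactSupport.isCompact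
    rw [Metric.tendstoUniformlyOn_iff] at this
    exact this ε hε
  obtain ⟨j, hj⟩ : ∃ j, h j ∈ U := by
    obtain ⟨_, ⟨j, rfl⟩, h1⟩ := hh.inter_nhds_nonempty hU
    exact ⟨j, h1⟩
  refine ⟨e.symm (n, some j), fun x => ?_⟩
  -- The cutoff is one on the support of `f`, so `f = f * g n` and the error is `|f - h j| * g n`.
  have key : |f x - h j x * g n x| ≤ ε * g n x := by
    by_cases hx : x ∈ tsupport (g n)
    · have : f x = f x * g n x := by
        by_cases hf : x ∈ tsupport f
        · rw [hg1 n x (Metric.closedBall_subset_closedBall hn (hr hf)), mul_one]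
        · rw [image_eq_zero_of_notMem_tsupport hf, zero_mul]
      rw [this, ← sub_mul, abs_mul, abs_of_nonneg (hg0 n x)]
      exact mul_le_mul_of_nonneg_right (hj x hx).le (hg0 n x)
    · have hf : f x = 0 := by
        by_contra hf
        have := hg1 n x (Metric.closedBall_subset_closedBall hn (hr (subset_tsupport _ hf)))
        rw [image_eq_zero_of_notMem_tsupport hx] at this
        exact zero_ne_one this
      simp [hf, image_eq_zero_of_notMem_tsupport hx]
  simpa [D] using key

/-- The vague topology is generated by countably many test functions. -/
lemma exists_isInducing : ∃ d : ℕ → C_c(ℝ, ℝ),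
    IsInducing fun (ξ : Conf ℝ) (j : ℕ) => ∫ x, d j x ∂ξ.toMeasure := by
  obtain ⟨d, hd⟩ := exists_countable_approx
  refine ⟨d, ⟨le_antisymm ?_ ?_⟩⟩
  · exact (continuous_pi fun j => continuous_integral (d j)).le_induced
  · refine le_iInf fun f => ?_
    rw [← continuous_iff_le_induced]
    let _ : TopologicalSpace (Conf ℝ) := TopologicalSpace.induced
      (fun (ξ : Conf ℝ) (j : ℕ) => ∫ x, d j x ∂ξ.toMeasure) inferInstance
    have hc (j : ℕ) : Continuous fun ξ : Conf ℝ => ∫ x, d j x ∂ξ.toMeasure :=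
      continuous_pi_iff.1 (continuous_induced_dom (f := fun (ξ : Conf ℝ) (j : ℕ) =>
        ∫ x, d j x ∂ξ.toMeasure)) j
    refine continuous_iff_continuousAt.2 fun ξ₀ => Metric.tendsto_nhds.2 fun ε hε => ?_
    obtain ⟨m, hm0, hm⟩ := hd f
    set C := ∫ x, d m x ∂ξ₀.toMeasure
    have hC : 0 ≤ C := integral_nonneg hm0
    -- Near `ξ₀` the weight integrates to less than `C + 1`, so the approximation costs at most `ε /
    -- 4` at each of `ξ` and `ξ₀`, leaving `ε / 2` for `d j`.
    obtain ⟨j, hj⟩ := hm (ε / (4 * (C + 1))) (by positivity)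
    filter_upwards [(hc m).continuousAt.eventually (gt_mem_nhds (lt_add_one C)),
      Metric.tendsto_nhds.1 (hc j).continuousAt (ε / 2) (by positivity)] with ξ h1 h2
    have a1 := abs_integral_sub_le ξ f (d j) (d m) hj
    have a2 := abs_integral_sub_le ξ₀ f (d j) (d m) hj
    have b1 : ε / (4 * (C + 1)) * ∫ x, d m x ∂ξ.toMeasure ≤ ε / 4 := by
      calc _ ≤ ε / (4 * (C + 1)) * (C + 1) := by gcongr
        _ = ε / 4 := by field_simp
    have b2 : ε / (4 * (C + 1)) * C < ε / 4 := by
      calc _ < ε / (4 * (C + 1)) * (C + 1) := by gcongr; linarith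
        _ = ε / 4 := by field_simp
    rw [Real.dist_eq] at h2 ⊢
    rw [abs_le] at a1 a2
    rw [abs_lt] at h2 ⊢
    constructor <;> linarith [a1.1, a1.2, a2.1, a2.2, h2.1, h2.2]

lemma measurable_integral (f : C_c(ℝ, ℝ)) :
    Measurable fun ξ : Conf ℝ => ∫ x, f x ∂ξ.toMeasure :=
  (continuous_integral f).measurable

/-- A map into the space of configurations is measurable as soon as the integrals of test functions
are. -/
lemma measurable_of_integral {Ω : Type*} [MeasurableSpace Ω] {T : Ω → Conf ℝ}
    (h : ∀ f : C_c(ℝ, ℝ), Measurable fun ω => ∫ x, f x ∂(T ω).toMeasure) : Measurable T := by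
  obtain ⟨d, hd⟩ := exists_isInducing
  -- An inducing map pulls the Borel σ-algebra back, and on the countable product `ℕ → ℝ` this is
  -- the product σ-algebra.
  have hb : Conf.instMeasurableSpace ℝ =
      MeasurableSpace.comap (fun (ξ : Conf ℝ) (j : ℕ) => ∫ x, d j x ∂ξ.toMeasure)
        (borel (ℕ → ℝ)) := by
    rw [← borel_comap, ← hd.eq_induced]
    rfl
  rw [hb, measurable_comap_iff, ← BorelSpace.measurable_eq (α := ℕ → ℝ)]
  exact measurable_pi_lambda _ fun j => h (d j)

lemma measurable_measure_compact {K : Set ℝ} (hK : IsCompact K) :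
    Measurable fun ξ : Conf ℝ => ξ.toMeasure K := by
  obtain ⟨f, hK1, hf, hf01⟩ : ∃ f : ℕ → C_c(ℝ, ℝ),
      (∀ x, Tendsto (fun n => f n x) atTop (𝓝 (K.indicator 1 x))) ∧
      (∃ B : Set ℝ, IsCompact B ∧ ∀ n x, x ∉ B → f n x = 0) ∧
      (∀ n x, f n x ∈ Set.Icc (0 : ℝ) 1) := by
    obtain ⟨g, h1, -, hc, h01⟩ := exists_continuous_one_zero_of_isCompact
      hK isClosed_empty (Set.disjoint_empty _)
    have hcl : closure K = K := hK.isClosed.closure_eq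
    -- Thickened indicators converge to the indicator of `closure K = K`; the factor `g`, equal to
    -- one on `K`, gives all of them one common compact support.
    let t : ℕ → C(ℝ, ℝ) := fun n => ⟨fun x => thickenedIndicator (δ := 1 / ((n : ℝ) + 1))
      (by positivity) K x, by fun_prop⟩
    refine ⟨fun n => ⟨t n * g, hc.mul_left⟩, fun x => ?_, ⟨_, hc.isCompact, fun n x hx => ?_⟩,
      fun n x => ?_⟩
    · have := tendsto_pi_nhds.1 (thickenedIndicator_tendsto_indicator_closure
        (δseq := fun n : ℕ => 1 / ((n : ℝ) + 1)) (fun n => by positivity)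
        tendsto_one_div_add_atTop_nhds_zero_nat K) x
      have h2 := ((NNReal.continuous_coe.tendsto _).comp this).mul_const (g x)
      refine h2.congr' (by rfl) |>.trans (le_of_eq ?_)
      rw [hcl]
      by_cases hx : x ∈ K
      · simp [hx, h1 hx]
      · simp [hx]
    · simp [image_eq_zero_of_notMem_tsupport hx]
    · have h2 := h01 x
      have h3 : (thickenedIndicator (δ := 1 / ((n : ℝ) + 1)) (by positivity) K x : ℝ) ≤ 1 :=
        mod_cast thickenedIndicator_le_one _ K x
      simp only [t, CompactlySupportedContinuousMap.coe_mk, ContinuousMap.mul_apply,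
        ContinuousMap.coe_mk]
      exact ⟨mul_nonneg NNReal.zero_le_coe h2.1, mul_le_one₀ h3 h2.1 h2.2⟩
  obtain ⟨B, hB, hfB⟩ := hf
  have hlim : ∀ ξ : Conf ℝ, Tendsto (fun n => ∫ x, f n x ∂ξ.toMeasure) atTop
      (𝓝 (ξ.toMeasure.real K)) := by
    intro ξ
    rw [← integral_indicator_one hK.measurableSet]
    refine tendsto_integral_of_dominated_convergence (B.indicator 1)
      (fun n => (f n).continuous.aestronglyMeasurable)
      ((integrable_indicator_iff hB.measurableSet).2
        (integrableOn_const hB.measure_lt_top.ne)) (fun n => ae_of_all _ fun x => ?_)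
      (ae_of_all _ hK1)
    by_cases hx : x ∈ B
    · simpa [hx, abs_of_nonneg (hf01 n x).1] using (hf01 n x).2
    · simp [hx, hfB n x hx]
  have hm := measurable_of_tendsto_metrizable (fun n => measurable_integral (f n))
    (tendsto_pi_nhds.2 hlim)
  have : (fun ξ : Conf ℝ => ξ.toMeasure K) = fun ξ => ENNReal.ofReal (ξ.toMeasure.real K) := by
    ext ξ
    rw [ofReal_measureReal hK.measure_lt_top.ne]
  rw [this]
  exact hm.ennreal_ofReal

/-- Compact intervals form a generating π-system, but the π-λ argument needs finite measures; hence
the restriction to `[-n, n]`, removed by a monotone limit. -/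
lemma measurable_toMeasure : Measurable fun ξ : Conf ℝ => ξ.toMeasure := by
  have hn (n : ℕ) : Measurable fun ξ : Conf ℝ =>
      ξ.toMeasure.restrict (Set.Icc (-n : ℝ) n) := by
    have (ξ : Conf ℝ) : IsFiniteMeasure (ξ.toMeasure.restrict (Set.Icc (-n : ℝ) n)) :=
      ⟨by rw [Measure.restrict_apply_univ]; exact isCompact_Icc.measure_lt_top⟩
    refine Measurable.measure_of_isPiSystem
      ((BorelSpace.measurable_eq).trans (borel_eq_generateFrom_Icc ℝ)) (isPiSystem_Icc id id) ?_ ?_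
    · rintro _ ⟨a, b, -, rfl⟩
      simp only [Measure.restrict_apply measurableSet_Icc]
      exact measurable_measure_compact (isCompact_Icc.inter isCompact_Icc)
    · simp only [Measure.restrict_apply_univ]
      exact measurable_measure_compact isCompact_Icc
  refine Measure.measurable_of_measurable_coe _ fun s hs => ?_
  have : (fun ξ : Conf ℝ => ξ.toMeasure s) =
      fun ξ => ⨆ n : ℕ, ξ.toMeasure.restrict (Set.Icc (-n : ℝ) n) s := by
    ext ξ
    have hU : s = ⋃ n : ℕ, s ∩ Set.Icc (-n : ℝ) n := by
      rw [← Set.inter_iUnion]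
      refine (Set.inter_eq_left.2 fun x _ => ?_).symm
      obtain ⟨n, hn⟩ := exists_nat_ge |x|
      exact Set.mem_iUnion.2 ⟨n, abs_le.1 hn⟩
    simp only [Measure.restrict_apply hs]
    conv_lhs => rw [hU]
    refine Monotone.measure_iUnion fun m n hmn => ?_
    have : (m : ℝ) ≤ n := by exact_mod_cast hmn
    exact Set.inter_subset_inter_right _ (Set.Icc_subset_Icc (by linarith) this)
  rw [this]
  exact Measurable.iSup fun n => Measure.measurable_coe hs |>.comp (hn n)

lemma measurable_measure {Δ : Set ℝ} (hΔ : MeasurableSet Δ) :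
    Measurable fun ξ : Conf ℝ => ξ.toMeasure Δ :=
  (Measure.measurable_coe hΔ).comp measurable_toMeasure

end Conf

/-! ### Characteristic functionals and convergence in law. -/

namespace Conf

/-- The characteristic functional `f ↦ E[exp (i ∫ f dξ)]` of the law of a random configuration. -/
noncomputable def charFunctional (P : Measure (Conf ℝ)) (f : ℝ → ℝ) : ℂ :=
  ∫ ξ, Complex.exp ((∫ x, f x ∂ξ.toMeasure : ℝ) * Complex.I) ∂P

/-- The characteristic functional of a random configuration determines its finite-dimensional
characteristic functions. -/
lemma charFun_map_toLp {n : ℕ} (d : Fin n → C_c(ℝ, ℝ)) (P : Measure (Conf ℝ))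
    (t : EuclideanSpace ℝ (Fin n)) :
    charFun (P.map fun ξ => WithLp.toLp 2 fun j => ∫ x, d j x ∂ξ.toMeasure) t =
      charFunctional P (∑ j, t j • d j : C_c(ℝ, ℝ)) := by
  have hm : Measurable fun ξ : Conf ℝ => WithLp.toLp 2 fun j => ∫ x, d j x ∂ξ.toMeasure :=
    (WithLp.measurable_toLp 2 _).comp (measurable_pi_lambda _ fun j => measurable_integral (d j))
  rw [charFunctional, charFun_apply, integral_map hm.aemeasurable (by fun_prop)]
  congr with ξ
  congr 3
  simp only [CompactlySupportedContinuousMap.coe_sum, Finset.sum_apply,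
    CompactlySupportedContinuousMap.coe_smul, Pi.smul_apply, smul_eq_mul]
  rw [integral_finsetSum _ fun j _ => (d j).integrable.const_mul _]
  simp only [integral_const_mul, PiLp.inner_apply, RCLike.inner_apply, conj_trivial]

/-- Lévy's theorem gives convergence of each projection to finitely many test integrals; the
portmanteau lower bound on open sets then passes through increasing unions of cylinders. -/
lemma tendsto_nat_of_tendsto_charFunctional {μs : ℕ → ProbabilityMeasure (Conf ℝ)}
    {P : ProbabilityMeasure (Conf ℝ)}
    (h : ∀ f : C_c(ℝ, ℝ), Tendsto (fun i => charFunctional (μs i) f) atTop (𝓝 (charFunctional P f))) :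
    Tendsto μs atTop (𝓝 P) := by
  obtain ⟨d, hd⟩ := exists_isInducing
  let Φ (n : ℕ) (ξ : Conf ℝ) : EuclideanSpace ℝ (Fin n) :=
    WithLp.toLp 2 fun j => ∫ x, d j x ∂ξ.toMeasure
  have hΦ (n : ℕ) : Continuous (Φ n) :=
    (PiLp.continuous_toLp 2 _).comp (continuous_pi fun j => continuous_integral (d j))
  have hlim (n : ℕ) : Tendsto (fun i => (μs i).map (hΦ n).aemeasurable) atTop
      (𝓝 (P.map (hΦ n).aemeasurable)) := by
    refine ProbabilityMeasure.tendsto_of_tendsto_charFun fun t => ?_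
    simp only [ProbabilityMeasure.toMeasure_map]
    have e (Q : Measure (Conf ℝ)) := charFun_map_toLp (fun j : Fin n => d j) Q t
    simp only [Φ, e]
    exact h _
  refine tendsto_of_forall_isOpen_le_liminf_nat' fun G hG => ?_
  -- Taking the largest admissible open set makes the cylinders automatically increasing in `n`.
  let W (n : ℕ) : Set (EuclideanSpace ℝ (Fin n)) := ⋃₀ {W | IsOpen W ∧ Φ n ⁻¹' W ⊆ G}
  have hW (n : ℕ) : IsOpen (W n) := isOpen_sUnion fun _ h => h.1
  have hWG (n : ℕ) : Φ n ⁻¹' W n ⊆ G := by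
    rintro ξ ⟨w, hw, hξ⟩
    exact hw.2 hξ
  have hmono : Monotone fun n => Φ n ⁻¹' W n := by
    rintro m n hmn ξ ⟨w, hw, hξ⟩
    let ρ : EuclideanSpace ℝ (Fin n) → EuclideanSpace ℝ (Fin m) :=
      fun y => WithLp.toLp 2 fun j => y (Fin.castLE hmn j)
    have hρ : Continuous ρ := by fun_prop
    exact ⟨ρ ⁻¹' w, ⟨hw.1.preimage hρ, hw.2⟩, hξ⟩
  have hU : G = ⋃ n, Φ n ⁻¹' W n := by
    refine Set.Subset.antisymm (fun ξ hξ => ?_) (Set.iUnion_subset hWG)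
    -- A basic neighbourhood in the product constrains finitely many coordinates, all below some
    -- `n`.
    obtain ⟨V, hV, rfl⟩ := hd.isOpen_iff.1 hG
    obtain ⟨I, u, hu, hIu⟩ := isOpen_pi_iff.1 hV _ hξ
    obtain ⟨n, hn⟩ := I.exists_nat_subset_range
    refine Set.mem_iUnion.2 ⟨n, ⋂ j : Fin n, {y | (j : ℕ) ∈ I → y j ∈ u j}, ⟨?_, ?_⟩, ?_⟩
    · refine isOpen_iInter_of_finite fun j => ?_
      by_cases hj : (j : ℕ) ∈ I
      · simp only [hj, forall_true_left]
        exact (hu j hj).1.preimage (by fun_prop)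
      · simp [hj]
    · intro η hη
      refine hIu fun j hj => ?_
      exact Set.mem_iInter.1 hη ⟨j, Finset.mem_range.1 (hn hj)⟩ hj
    · exact Set.mem_iInter.2 fun j hj => (hu j hj).2
  conv_lhs => rw [hU, hmono.measure_iUnion]
  refine iSup_le fun n => ?_
  have key := ProbabilityMeasure.le_liminf_measure_open_of_tendsto (hlim n) (hW n)
  simp only [ProbabilityMeasure.toMeasure_map,
    Measure.map_apply (hΦ n).measurable (hW n).measurableSet] at key
  exact key.trans (liminf_le_liminf (Eventually.of_forall fun i => measure_mono (hWG n)))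

/-- Convergence of characteristic functionals implies convergence in law of random
configurations. -/
theorem tendsto_of_tendsto_charFunctional {ι : Type*} {L : Filter ι} [L.IsCountablyGenerated]
    {μs : ι → ProbabilityMeasure (Conf ℝ)} {P : ProbabilityMeasure (Conf ℝ)}
    (h : ∀ f : C_c(ℝ, ℝ), Tendsto (fun i => charFunctional (μs i) f) L (𝓝 (charFunctional P f))) :
    Tendsto μs L (𝓝 P) :=
  tendsto_of_seq_tendsto fun _ hu =>
    tendsto_nat_of_tendsto_charFunctional fun f => (h f).comp hu

end Conf

/-! ### Step functions and the characterisation of Poisson laws. -/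

namespace Conf

/-- The step function with value `y i` on `Δ i`. -/
noncomputable def step {k : ℕ} (Δ : Fin k → Set ℝ) (y : Fin k → ℝ) (x : ℝ) : ℝ :=
  ∑ i, (Δ i).indicator (fun _ => y i) x

lemma measure_lt_top_of_isCompact_closure {m : Measure ℝ} [IsFiniteMeasureOnCompacts m] {Δ : Set ℝ}
    (hΔ : IsCompact (closure Δ)) : m Δ < ∞ :=
  (measure_mono subset_closure).trans_lt hΔ.measure_lt_top

section Step

variable {k : ℕ} {Δ : Fin k → Set ℝ}

lemma integral_step {m : Measure ℝ} [IsFiniteMeasureOnCompacts m] (hΔ : ∀ i, MeasurableSet (Δ i))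
    (hc : ∀ i, IsCompact (closure (Δ i))) (y : Fin k → ℝ) :
    ∫ x, step Δ y x ∂m = ∑ i, y i * m.real (Δ i) := by
  simp only [step]
  rw [integral_finsetSum]
  · refine Finset.sum_congr rfl fun i _ => ?_
    rw [integral_indicator_const _ (hΔ i), smul_eq_mul, mul_comm]
  · exact fun i _ => (integrable_indicator_iff (hΔ i)).2
      (integrableOn_const (measure_lt_top_of_isCompact_closure (hc i)).ne)

lemma comp_step (hd : Pairwise fun i j => Disjoint (Δ i) (Δ j)) (y : Fin k → ℝ) {g : ℝ → ℂ}
    (hg : g 0 = 0) (x : ℝ) : g (step Δ y x) = ∑ i, (Δ i).indicator (fun _ => g (y i)) x := by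
  by_cases hx : ∃ i, x ∈ Δ i
  · obtain ⟨i, hi⟩ := hx
    have hj : ∀ j, j ≠ i → x ∉ Δ j := fun j hji hxj =>
      Set.disjoint_left.1 (hd hji) hxj hi
    rw [step, Finset.sum_eq_single i (fun j _ hji => Set.indicator_of_notMem (hj j hji) _)
      (by simp), Finset.sum_eq_single i (fun j _ hji => Set.indicator_of_notMem (hj j hji) _)
      (by simp), Set.indicator_of_mem hi, Set.indicator_of_mem hi]
  · push Not at hx
    simp [step, hx, hg]

lemma integral_exp_step {m : Measure ℝ} [IsFiniteMeasureOnCompacts m]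
    (hΔ : ∀ i, MeasurableSet (Δ i)) (hc : ∀ i, IsCompact (closure (Δ i)))
    (hd : Pairwise fun i j => Disjoint (Δ i) (Δ j)) (y : Fin k → ℝ) :
    ∫ x, (Complex.exp (step Δ y x * Complex.I) - 1) ∂m =
      ∑ i, m.real (Δ i) * (Complex.exp (y i * Complex.I) - 1) := by
  simp only [comp_step hd y (g := fun t => Complex.exp (t * Complex.I) - 1) (by simp)]
  rw [integral_finsetSum]
  · refine Finset.sum_congr rfl fun i _ => ?_
    rw [integral_indicator_const _ (hΔ i), Complex.real_smul]
  · exact fun i _ => (integrable_indicator_iff (hΔ i)).2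
      (integrableOn_const (measure_lt_top_of_isCompact_closure (hc i)).ne)

end Step

lemma measurable_measureReal {Δ : Set ℝ} (hΔ : MeasurableSet Δ) :
    Measurable fun ξ : Conf ℝ => ξ.toMeasure.real Δ :=
  (measurable_measure hΔ).ennreal_toReal

/-- The law of the number of points, as an integer-valued or as a real-valued variable. -/
lemma map_measureReal_eq_iff {P : Measure (Conf ℝ)} {Δ : Set ℝ}
    (hΔ : MeasurableSet Δ) (hc : IsCompact (closure Δ)) (r : ℝ≥0) :
    P.map (fun ξ => ξ.toMeasure.real Δ) = (poissonMeasure r).map ((↑) : ℕ → ℝ) ↔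
      ∀ n : ℕ, P {ξ | ξ.toMeasure Δ = n} = poissonMeasure r {n} := by
  have hreal (ξ : Conf ℝ) (n : ℕ) : ξ.toMeasure.real Δ = n ↔ ξ.toMeasure Δ = n := by
    obtain ⟨m, hm⟩ := ξ.exists_nat_eq hΔ hc
    simp [measureReal_def, hm]
  constructor
  · intro h n
    have h1 : P.map (fun ξ => ξ.toMeasure.real Δ) {(n : ℝ)} =
        (poissonMeasure r).map ((↑) : ℕ → ℝ) {(n : ℝ)} := by rw [h]
    rw [Measure.map_apply (measurable_measureReal hΔ) (measurableSet_singleton _),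
      Measure.map_apply .of_discrete (measurableSet_singleton _)] at h1
    convert h1 using 2
    · ext ξ; simp [hreal]
    · ext m; simp
  · intro h
    -- The floor loses nothing, since counts are integers; it makes the count a variable in `ℕ`,
    -- whose law is fixed by singletons.
    let N : Conf ℝ → ℕ := fun ξ => ⌊ξ.toMeasure.real Δ⌋₊
    have hN : Measurable N := Nat.measurable_floor.comp (measurable_measureReal hΔ)
    have hNr (ξ : Conf ℝ) : (N ξ : ℝ) = ξ.toMeasure.real Δ := by
      obtain ⟨n, hn⟩ := ξ.exists_nat_eq hΔ hc
      simp [N, measureReal_def, hn]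
    have : P.map N = poissonMeasure r := by
      refine Measure.ext_of_singleton fun n => ?_
      rw [Measure.map_apply hN (measurableSet_singleton _), ← h n]
      congr 1
      ext ξ
      simp [← hreal, ← hNr]
    rw [← this, Measure.map_map .of_discrete hN]
    congr 1
    ext ξ
    exact (hNr ξ).symm

lemma charFunctional_step {k : ℕ} {Δ : Fin k → Set ℝ} (P : Measure (Conf ℝ))
    (hΔ : ∀ i, MeasurableSet (Δ i)) (hc : ∀ i, IsCompact (closure (Δ i))) (y : Fin k → ℝ) :
    charFunctional P (step Δ y) =
      ∫ ξ, Complex.exp ((∑ i, y i * ξ.toMeasure.real (Δ i) : ℝ) * Complex.I) ∂P := by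
  simp only [charFunctional, integral_step hΔ hc]

lemma charFun_map_measureReal {P : Measure (Conf ℝ)} {Δ : Set ℝ} (hΔ : MeasurableSet Δ) (y : ℝ) :
    charFun (P.map fun ξ => ξ.toMeasure.real Δ) y =
      ∫ ξ, Complex.exp (y * ξ.toMeasure.real Δ * Complex.I) ∂P := by
  rw [charFun_apply_real, integral_map (measurable_measureReal hΔ).aemeasurable (by fun_prop)]

/-- Independence of the counts factorises the expectation, and each factor is a Poisson
characteristic function. -/
lemma charFunctional_step_of_isPoissonLaw {ν : Measure ℝ} [IsLocallyFiniteMeasure ν]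
    {P : Measure (Conf ℝ)} (hP : IsPoissonLaw ν P)
    {k : ℕ} {Δ : Fin k → Set ℝ} (hΔ : ∀ i, MeasurableSet (Δ i))
    (hc : ∀ i, IsCompact (closure (Δ i))) (hd : Pairwise fun i j => Disjoint (Δ i) (Δ j))
    (y : Fin k → ℝ) :
    charFunctional P (step Δ y) =
      Complex.exp (∫ x, (Complex.exp (step Δ y x * Complex.I) - 1) ∂ν) := by
  rw [charFunctional_step P hΔ hc, integral_exp_step hΔ hc hd, Complex.exp_sum]
  have h1 (ξ : Conf ℝ) :
      Complex.exp ((∑ i, y i * ξ.toMeasure.real (Δ i) : ℝ) * Complex.I) =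
      ∏ i, (fun e : ℝ≥0∞ => Complex.exp (y i * e.toReal * Complex.I)) (ξ.toMeasure (Δ i)) := by
    rw [← Complex.exp_sum]
    push_cast
    rw [Finset.sum_mul]
    rfl
  simp only [h1]
  rw [(hP.indep k Δ hΔ hc hd).integral_fun_prod_comp
    (f := fun i e => Complex.exp (y i * e.toReal * Complex.I))
    (fun i => (measurable_measure (hΔ i)).aemeasurable) (fun i => by fun_prop)]
  refine Finset.prod_congr rfl fun i _ => ?_
  have h2 := charFun_map_measureReal (P := P) (hΔ i) (y i)
  rw [(map_measureReal_eq_iff (hΔ i) (hc i) _).2 (hP.count _ (hΔ i) (hc i)),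
    charFun_map_cast_poissonMeasure] at h2
  exact h2.symm

lemma exists_step_eq_simpleFunc (s : SimpleFunc ℝ ℝ) {K : Set ℝ} (hK : IsCompact K)
    (hs : ∀ x ∉ K, s x = 0) : ∃ (k : ℕ) (Δ : Fin k → Set ℝ) (y : Fin k → ℝ),
    (∀ i, MeasurableSet (Δ i)) ∧ (∀ i, IsCompact (closure (Δ i))) ∧
    (Pairwise fun i j => Disjoint (Δ i) (Δ j)) ∧ step Δ y = s := by
  classical
  -- The value zero is discarded because its level set is unbounded.
  let F := s.range.filter (· ≠ 0)
  let e := F.equivFin.symm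
  refine ⟨F.card, fun i => s ⁻¹' {(e i : ℝ)}, fun i => e i, fun i => s.measurableSet_fiber _,
    fun i => ?_, fun i j hij => ?_, ?_⟩
  · refine hK.of_isClosed_subset isClosed_closure (closure_minimal (fun x hx => ?_) hK.isClosed)
    by_contra hxK
    exact (Finset.mem_filter.1 (e i).2).2 ((Set.mem_singleton_iff.1 hx).symm.trans (hs x hxK))
  · refine Set.disjoint_left.2 fun x hi hj => hij (e.injective (Subtype.ext ?_))
    exact (Set.mem_singleton_iff.1 hi).symm.trans (Set.mem_singleton_iff.1 hj)
  · ext x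
    rw [step, e.sum_comp fun z : F => (s ⁻¹' {(z : ℝ)}).indicator (fun _ => (z : ℝ)) x,
      Finset.sum_coe_sort F fun z => (s ⁻¹' {z}).indicator (fun _ => z) x]
    by_cases h0 : s x = 0
    · rw [h0]
      refine Finset.sum_eq_zero fun z hz => Set.indicator_of_notMem (fun hx => ?_) _
      exact (Finset.mem_filter.1 hz).2 ((Set.mem_singleton_iff.1 hx).symm.trans h0)
    · rw [Finset.sum_eq_single (s x)]
      · simp
      · intro z _ hz
        simp [hz.symm]
      · intro h
        exact absurd (Finset.mem_filter.2 ⟨s.mem_range_self x, h0⟩) h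

/-- The characteristic functional of a Poisson point process. -/
theorem charFunctional_of_isPoissonLaw {ν : Measure ℝ} [IsLocallyFiniteMeasure ν]
    {P : Measure (Conf ℝ)} [IsProbabilityMeasure P] (hP : IsPoissonLaw ν P) (f : C_c(ℝ, ℝ)) :
    charFunctional P f = Complex.exp (∫ x, (Complex.exp (f x * Complex.I) - 1) ∂ν) := by
  let s : ℕ → SimpleFunc ℝ ℝ :=
    SimpleFunc.approxOn f f.continuous.measurable Set.univ 0 (Set.mem_univ _)
  -- This bound both dominates the approximations, under `ν` and every configuration, and confines
  -- them to the support of `f`.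
  have hs (n : ℕ) (x : ℝ) : ‖s n x‖ ≤ ‖f x‖ + ‖f x‖ :=
    SimpleFunc.norm_approxOn_zero_le _ (Set.mem_univ _) x n
  have hlim (x : ℝ) : Tendsto (fun n => s n x) atTop (𝓝 (f x)) :=
    SimpleFunc.tendsto_approxOn _ _ (by simp)
  have hint (m : Measure ℝ) [IsFiniteMeasureOnCompacts m] :
      Integrable (fun x => ‖f x‖ + ‖f x‖) m := f.integrable.norm.add f.integrable.norm
  have hstep (n : ℕ) : charFunctional P (s n) =
      Complex.exp (∫ x, (Complex.exp (s n x * Complex.I) - 1) ∂ν) := by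
    obtain ⟨k, Δ, y, hΔ, hc, hd, h⟩ := exists_step_eq_simpleFunc (s n)
      f.hasCompactSupport.isCompact fun x hx => by
        have := hs n x
        rw [image_eq_zero_of_notMem_tsupport hx] at this
        simpa using this
    rw [← h]
    exact charFunctional_step_of_isPoissonLaw hP hΔ hc hd y
  have hξ (ξ : Conf ℝ) : Tendsto (fun n => ∫ x, s n x ∂ξ.toMeasure) atTop
      (𝓝 (∫ x, f x ∂ξ.toMeasure)) :=
    tendsto_integral_of_dominated_convergence _ (fun n => (s n).aestronglyMeasurable)
      (hint _) (fun n => ae_of_all _ (hs n)) (ae_of_all _ hlim)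
  have hmeas (n : ℕ) : Measurable fun ξ : Conf ℝ => ∫ x, s n x ∂ξ.toMeasure := by
    obtain ⟨k, Δ, y, hΔ, hc, -, h⟩ := exists_step_eq_simpleFunc (s n)
      f.hasCompactSupport.isCompact fun x hx => by
        have := hs n x
        rw [image_eq_zero_of_notMem_tsupport hx] at this
        simpa using this
    simp only [← h, integral_step hΔ hc]
    exact Finset.measurable_sum _ fun i _ => (measurable_measureReal (hΔ i)).const_mul _
  have hL : Tendsto (fun n => charFunctional P (s n)) atTop (𝓝 (charFunctional P f)) := by
    refine tendsto_integral_of_dominated_convergence (fun _ => 1) (fun n => ?_)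
      (integrable_const _) (fun n => ae_of_all _ fun ξ => ?_) (ae_of_all _ fun ξ => ?_)
    · exact ((by fun_prop : Measurable fun t : ℝ => Complex.exp (t * Complex.I)).comp
        (hmeas n)).aestronglyMeasurable
    · rw [Complex.norm_exp_ofReal_mul_I]
    · have : Continuous fun t : ℝ => Complex.exp (t * Complex.I) := by fun_prop
      exact (this.tendsto _).comp (hξ ξ)
  have hR : Tendsto (fun n => Complex.exp (∫ x, (Complex.exp (s n x * Complex.I) - 1) ∂ν)) atTop
      (𝓝 (Complex.exp (∫ x, (Complex.exp (f x * Complex.I) - 1) ∂ν))) := by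
    refine (Complex.continuous_exp.tendsto _).comp ?_
    refine tendsto_integral_of_dominated_convergence _ (fun n => ?_) (hint ν)
      (fun n => ae_of_all _ fun x => ?_) (ae_of_all _ fun x => ?_)
    · have := (s n).measurable
      fun_prop
    · refine le_trans ?_ (hs n x)
      rw [mul_comm]
      exact Real.norm_exp_I_mul_ofReal_sub_one_le
    · have : Continuous fun t : ℝ => Complex.exp (t * Complex.I) - 1 := by fun_prop
      exact (this.tendsto _).comp (hlim x)
  exact tendsto_nhds_unique hL (by simpa only [hstep] using hR)

/-- A random configuration whose characteristic functional on step functions is that of a Poisson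
point process is a Poisson point process. -/
theorem isPoissonLaw_of_charFunctional_step {ν : Measure ℝ} [IsLocallyFiniteMeasure ν]
    {P : Measure (Conf ℝ)} [IsProbabilityMeasure P]
    (h : ∀ (k : ℕ) (Δ : Fin k → Set ℝ) (y : Fin k → ℝ), (∀ i, MeasurableSet (Δ i)) →
      (∀ i, IsCompact (closure (Δ i))) → (Pairwise fun i j => Disjoint (Δ i) (Δ j)) →
      charFunctional P (step Δ y) =
        Complex.exp (∫ x, (Complex.exp (step Δ y x * Complex.I) - 1) ∂ν)) :
    IsPoissonLaw ν P := by
  have hcount (Δ : Set ℝ) (hΔ : MeasurableSet Δ) (hc : IsCompact (closure Δ)) (y : ℝ) :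
      charFun (P.map fun ξ => ξ.toMeasure.real Δ) y =
        Complex.exp (ν.real Δ * (Complex.exp (y * Complex.I) - 1)) := by
    have := h 1 (fun _ => Δ) (fun _ => y) (fun _ => hΔ) (fun _ => hc) (fun i j hij =>
      absurd (Subsingleton.elim i j) hij)
    rw [charFunctional_step P (fun _ => hΔ) (fun _ => hc), integral_exp_step (fun _ => hΔ)
      (fun _ => hc) (fun i j hij => absurd (Subsingleton.elim i j) hij)] at this
    rw [charFun_map_measureReal hΔ]
    simpa using this
  refine ⟨fun Δ hΔ hc => (map_measureReal_eq_iff hΔ hc _).1 ?_, fun k Δ hΔ hc hd => ?_⟩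
  · have := Measure.isProbabilityMeasure_map (μ := P) (measurable_measureReal hΔ).aemeasurable
    refine Measure.ext_of_charFun (funext fun y => ?_)
    rw [hcount Δ hΔ hc, charFun_map_cast_poissonMeasure]
    rfl
  -- With the values `y i` as Fourier variables, the functional on step functions is the joint
  -- characteristic function of the counts; its exponential form factorises.
  · have hi : iIndepFun (fun i (ξ : Conf ℝ) => ξ.toMeasure.real (Δ i)) P := by
      rw [iIndepFun_iff_charFun_pi fun i => (measurable_measureReal (hΔ i)).aemeasurable]
      intro t
      have hm : Measurable fun ξ : Conf ℝ =>
          (WithLp.toLp 2 fun i => ξ.toMeasure.real (Δ i) : EuclideanSpace ℝ (Fin k)) :=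
        (WithLp.measurable_toLp 2 _).comp
          (measurable_pi_lambda _ fun i => measurable_measureReal (hΔ i))
      simp only [hcount _ (hΔ _) (hc _)]
      rw [← Complex.exp_sum, ← integral_exp_step hΔ hc hd, ← h k Δ _ hΔ hc hd,
        charFunctional_step P hΔ hc, charFun_apply, integral_map hm.aemeasurable (by fun_prop)]
      simp [PiLp.inner_apply]
    have := hi.comp (fun _ => ENNReal.ofReal) fun _ => ENNReal.measurable_ofReal
    convert this using 3 with i ξ
    exact (ofReal_measureReal (measure_lt_top_of_isCompact_closure (hc i)).ne).symm

end Conf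

/-! ### Existence of the Poisson point process. -/

lemma integral_prod_range_of_iIndepFun {Ω 𝓧 : Type*} [MeasurableSpace Ω] [MeasurableSpace 𝓧]
    {μ : Measure Ω} {X : ℕ → Ω → 𝓧} (hX : iIndepFun X μ) (hm : ∀ n, Measurable (X n))
    {f : ℕ → 𝓧 → ℂ} (hf : ∀ n, Measurable (f n)) (N : ℕ) :
    ∫ ω, ∏ n ∈ Finset.range N, f n (X n ω) ∂μ =
      ∏ n ∈ Finset.range N, ∫ ω, f n (X n ω) ∂μ := by
  simp only [Finset.prod_range]
  exact (hX.precomp Fin.val_injective).integral_fun_prod_comp (f := fun i : Fin N => f i)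
    (fun i => (hm i).aemeasurable) fun i => (hf i).aestronglyMeasurable

namespace Conf

/-- The annuli `k ≤ |x| < k + 1` that partition the line. -/
def annulus (k : ℕ) : Set ℝ := {x | ⌊|x|⌋₊ = k}

lemma measurableSet_annulus (k : ℕ) : MeasurableSet (annulus k) :=
  (by fun_prop : Measurable fun x : ℝ => ⌊|x|⌋₊) (measurableSet_singleton k)

lemma measure_annulus_lt_top (ν : Measure ℝ) [IsLocallyFiniteMeasure ν] (k : ℕ) :
    ν (annulus k) < ∞ := by
  refine (measure_mono fun x hx => ?_).trans_lt
    (isCompact_closedBall (0 : ℝ) (k + 1)).measure_lt_top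
  rw [mem_closedBall_zero_iff, Real.norm_eq_abs]
  have := Nat.lt_floor_add_one |x|
  rw [show ⌊|x|⌋₊ = k from hx] at this
  exact this.le

/-- For each annulus, a number of points and a sequence of candidate positions. -/
abbrev Marks : Type := ℕ → ℕ × (ℕ → ℝ)

/-- The indices of the points retained from `ω`. -/
abbrev Retained (ω : Marks) : Type :=
  {p : Σ _ : ℕ, ℕ // p.2 < (ω p.1).1 ∧ (ω p.1).2 p.2 ∈ annulus p.1}

/-- Only annuli of index below `K` contribute, each with finitely many candidates. As `Retained`
tests membership in the annulus, this holds for every `ω`, not just almost surely. -/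
lemma finite_retained (ω : Marks) (K : ℕ) :
    {i : Retained ω | |(ω i.1.1).2 i.1.2| < K}.Finite := by
  refine (((Finset.range K).sigma fun k => Finset.range (ω k).1).finite_toSet.preimage
    (Subtype.val_injective.injOn)).subset fun i hi => ?_
  have h1 : ⌊|(ω i.1.1).2 i.1.2|⌋₊ = i.1.1 := i.2.2
  have h2 : i.1.1 < K := by
    rw [← h1]
    exact (Nat.floor_lt (abs_nonneg _)).2 hi
  simp [h2, i.2.1]

/-- The configuration formed by the points of `ω`. -/
noncomputable def ofMarks (ω : Marks) : Conf ℝ where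
  toMeasure := Measure.sum fun i : Retained ω => Measure.dirac ((ω i.1.1).2 i.1.2)
  isCounting := ⟨Retained ω, inferInstance, _, rfl⟩
  locallyFinite Δ hΔ hc := by
    obtain ⟨r, hr⟩ := hc.isBounded.subset_closedBall 0
    obtain ⟨K, hK⟩ := exists_nat_gt r
    rw [Measure.sum_apply _ hΔ, tsum_eq_sum (s := (finite_retained ω K).toFinset)]
    · exact ENNReal.sum_lt_top.2 fun i _ => measure_lt_top _ _
    · intro i hi
      rw [Measure.dirac_apply' _ hΔ]
      refine Set.indicator_of_notMem (fun hx => hi ?_) _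
      have := hr (subset_closure hx)
      rw [mem_closedBall_zero_iff, Real.norm_eq_abs] at this
      simpa using this.trans_lt hK

/-- The contribution of the annulus `k` to the integral of `f`. -/
noncomputable def annulusSum (f : ℝ → ℝ) (k : ℕ) (q : ℕ × (ℕ → ℝ)) : ℝ :=
  ∑ j ∈ Finset.range q.1, (annulus k).indicator f (q.2 j)

lemma measurable_annulusSum {f : ℝ → ℝ} (hf : Measurable f) (k : ℕ) :
    Measurable (annulusSum f k) := by
  refine measurable_from_prod_countable_right fun n => ?_
  exact Finset.measurable_sum (Finset.range n) fun j _ =>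
    (hf.indicator (measurableSet_annulus k)).comp (measurable_pi_apply j)

lemma integral_ofMarks {f : ℝ → ℝ} {K : ℕ} (hf : ∀ x, (K : ℝ) ≤ |x| → f x = 0) (ω : Marks) :
    ∫ x, f x ∂(ofMarks ω).toMeasure = ∑ k ∈ Finset.range K, annulusSum f k (ω k) := by
  classical
  have hsupp (i : Retained ω) (hi : i ∉ (finite_retained ω K).toFinset) :
      f ((ω i.1.1).2 i.1.2) = 0 := hf _ (by simpa using hi)
  have h := hasSum_integral_sum_dirac (f := f) (x := fun i : Retained ω => (ω i.1.1).2 i.1.2)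
    (c := fun _ => 1) (fun _ => ENNReal.one_ne_top)
    (summable_of_ne_finset_zero (s := (finite_retained ω K).toFinset) fun i hi => by
      simp [hsupp i hi])
  simp only [one_smul, ENNReal.toReal_one] at h
  change ∫ x, f x ∂Measure.sum _ = _
  rw [← h.tsum_eq]
  have h2 := tsum_subtype {p : Σ _ : ℕ, ℕ | p.2 < (ω p.1).1 ∧ (ω p.1).2 p.2 ∈ annulus p.1}
    fun p => f ((ω p.1).2 p.2)
  refine h2.trans ?_
  rw [tsum_eq_sum (s := (Finset.range K).sigma fun k => Finset.range (ω k).1), Finset.sum_sigma]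
  · refine Finset.sum_congr rfl fun k _ => Finset.sum_congr rfl fun j hj => ?_
    have hj' := Finset.mem_range.1 hj
    by_cases hA : (ω k).2 j ∈ annulus k
    · rw [Set.indicator_of_mem hA, Set.indicator_of_mem]
      exact ⟨hj', hA⟩
    · rw [Set.indicator_of_notMem hA, Set.indicator_of_notMem]
      exact fun h => hA h.2
  · intro p hp
    by_cases hp' : p ∈ {p : Σ _ : ℕ, ℕ | p.2 < (ω p.1).1 ∧ (ω p.1).2 p.2 ∈ annulus p.1}
    · rw [Set.indicator_of_mem hp']
      apply hf
      have h1 : ⌊|(ω p.1).2 p.2|⌋₊ = p.1 := hp'.2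
      have h3 : K ≤ p.1 := by
        by_contra hlt
        exact hp (by simpa using ⟨not_le.1 hlt, hp'.1⟩)
      rw [← h1] at h3
      exact (Nat.le_floor_iff (abs_nonneg _)).1 h3
    · exact Set.indicator_of_notMem hp' _

lemma measurable_ofMarks : Measurable ofMarks := by
  refine measurable_of_integral fun f => ?_
  obtain ⟨r, hr⟩ := f.hasCompactSupport.isCompact.isBounded.subset_closedBall 0
  obtain ⟨K, hK⟩ := exists_nat_gt r
  have hf : ∀ x, (K : ℝ) ≤ |x| → f x = 0 := fun x hx => by
    by_contra h
    have := hr (subset_tsupport _ h)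
    rw [mem_closedBall_zero_iff, Real.norm_eq_abs] at this
    linarith
  simp only [integral_ofMarks hf]
  exact Finset.measurable_sum _ fun k _ =>
    (measurable_annulusSum f.continuous.measurable k).comp (measurable_pi_apply k)

section Law

variable (ν : Measure ℝ) [IsLocallyFiniteMeasure ν]

open Classical in
/-- The law of a point of the annulus `k`. -/
noncomputable def positionLaw (k : ℕ) : Measure ℝ :=
  -- The default only keeps this a probability measure: a null annulus receives a Poisson number of
  -- points of mean zero.
  if ν (annulus k) = 0 then Measure.dirac 0 else cond ν (annulus k)

instance (k : ℕ) : IsProbabilityMeasure (positionLaw ν k) := by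
  unfold positionLaw
  split_ifs with h
  · infer_instance
  · exact cond_isProbabilityMeasure_of_finite h (measure_annulus_lt_top ν k).ne

/-- The law of the number and of the positions of the points of the annulus `k`. -/
noncomputable def annulusLaw (k : ℕ) : Measure (ℕ × (ℕ → ℝ)) :=
  (poissonMeasure (ν (annulus k)).toNNReal).prod (Measure.infinitePi fun _ : ℕ => positionLaw ν k)

instance (k : ℕ) : IsProbabilityMeasure (annulusLaw ν k) := by
  unfold annulusLaw
  infer_instance

/-- The law of the marks of the Poisson point process. -/
noncomputable def markLaw : Measure Marks := Measure.infinitePi (annulusLaw ν)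

instance : IsProbabilityMeasure (markLaw ν) := by
  unfold markLaw
  infer_instance

lemma integrable_exp_indicator_sub_one {f : ℝ → ℝ} (hf : Measurable f) (k : ℕ) :
    Integrable (fun x => Complex.exp ((annulus k).indicator f x * Complex.I) - 1) ν := by
  have hm : Measurable fun x => Complex.exp ((annulus k).indicator f x * Complex.I) - 1 := by
    have := hf.indicator (measurableSet_annulus k)
    fun_prop
  refine Integrable.mono' (g := (annulus k).indicator fun _ => 2)
    ((integrable_indicator_iff (measurableSet_annulus k)).2
      (integrableOn_const (measure_annulus_lt_top ν k).ne)) hm.aestronglyMeasurable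
    (ae_of_all _ fun x => ?_)
  by_cases hx : x ∈ annulus k
  · rw [Set.indicator_of_mem hx, Set.indicator_of_mem hx]
    refine (norm_sub_le _ _).trans ?_
    rw [Complex.norm_exp_ofReal_mul_I, norm_one]
    norm_num
  · simp [hx]

lemma integral_exp_positionLaw {f : ℝ → ℝ} (hf : Measurable f) (k : ℕ) :
    (ν.real (annulus k) : ℂ) *
      ((∫ x, Complex.exp ((annulus k).indicator f x * Complex.I) ∂positionLaw ν k) - 1) =
    ∫ x, (Complex.exp ((annulus k).indicator f x * Complex.I) - 1) ∂ν := by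
  have hm := hf.indicator (measurableSet_annulus k)
  have hset : ∫ x, (Complex.exp ((annulus k).indicator f x * Complex.I) - 1) ∂ν =
      ∫ x in annulus k, (Complex.exp ((annulus k).indicator f x * Complex.I) - 1) ∂ν := by
    refine (setIntegral_eq_integral_of_forall_compl_eq_zero fun x hx => ?_).symm
    simp [hx]
  have hsub : (∫ x, Complex.exp ((annulus k).indicator f x * Complex.I) ∂positionLaw ν k) - 1 =
      ∫ x, (Complex.exp ((annulus k).indicator f x * Complex.I) - 1) ∂positionLaw ν k := by
    rw [integral_sub _ (integrable_const _)]
    · simp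
    · refine Integrable.of_bound (by fun_prop) 1 (ae_of_all _ fun x => ?_)
      rw [Complex.norm_exp_ofReal_mul_I]
  rw [hsub, hset]
  by_cases h0 : ν (annulus k) = 0
  · rw [Measure.restrict_eq_zero.2 h0]
    simp [measureReal_def, h0]
  · rw [positionLaw, if_neg h0, ProbabilityTheory.cond, integral_smul_measure, ENNReal.toReal_inv,
      Complex.real_smul, ← mul_assoc, ← measureReal_def]
    have : ν.real (annulus k) ≠ 0 := by
      rw [measureReal_def]
      exact ENNReal.toReal_ne_zero.2 ⟨h0, (measure_annulus_lt_top ν k).ne⟩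
    rw [← Complex.ofReal_mul, mul_inv_cancel₀ this]
    simp

/-- A compound Poisson computation: given `n` points the expectation is `φ ^ n`, and averaging over
a Poisson `n` of mean `r` gives `exp (r (φ - 1))`. -/
lemma integral_exp_annulusSum {f : ℝ → ℝ} (hf : Measurable f) (k : ℕ) :
    ∫ q, Complex.exp (annulusSum f k q * Complex.I) ∂annulusLaw ν k =
      Complex.exp (∫ x, (Complex.exp ((annulus k).indicator f x * Complex.I) - 1) ∂ν) := by
  set h := (annulus k).indicator f with hh
  have hm : Measurable h := hf.indicator (measurableSet_annulus k)
  set φ := ∫ x, Complex.exp (h x * Complex.I) ∂positionLaw ν k with hφ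
  set r := (ν (annulus k)).toNNReal with hr
  have hint : Integrable (fun q => Complex.exp (annulusSum f k q * Complex.I))
      (annulusLaw ν k) := by
    have := measurable_annulusSum hf k
    refine Integrable.of_bound (by fun_prop) 1 (ae_of_all _ fun x => ?_)
    rw [Complex.norm_exp_ofReal_mul_I]
  have hn (n : ℕ) : ∫ y, Complex.exp (annulusSum f k (n, y) * Complex.I)
      ∂Measure.infinitePi (fun _ : ℕ => positionLaw ν k) = φ ^ n := by
    have e (y : ℕ → ℝ) : Complex.exp (annulusSum f k (n, y) * Complex.I) =
        ∏ j ∈ Finset.range n, (fun x : ℝ => Complex.exp (h x * Complex.I)) (y j) := by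
      rw [← Complex.exp_sum, annulusSum]
      push_cast
      rw [Finset.sum_mul]
    simp only [e]
    rw [integral_prod_range_of_iIndepFun (X := fun j (y : ℕ → ℝ) => y j)
      (f := fun _ x => Complex.exp (h x * Complex.I))
      (iIndepFun_infinitePi (X := fun _ => id) fun _ => measurable_id)
      (fun j => measurable_pi_apply j) (fun _ => by fun_prop)]
    rw [Finset.prod_congr rfl fun j _ => ?_, Finset.prod_const, Finset.card_range]
    have := Measure.infinitePi_map_eval (fun _ : ℕ => positionLaw ν k) j
    rw [hφ]
    conv_rhs => rw [← this]
    rw [integral_map (measurable_pi_apply j).aemeasurable (by fun_prop)]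
  rw [annulusLaw, integral_prod _ hint]
  simp only [hn]
  rw [integral_poissonMeasure, ← integral_exp_positionLaw ν hf k, ← hh, ← hφ]
  have hr' : ν.real (annulus k) = r := rfl
  rw [hr']
  calc ∑' n, (Real.exp (-r) * r ^ n / n.factorial : ℝ) • φ ^ n
      = ∑' n, (Real.exp (-r) : ℂ) * ((r * φ) ^ n / n.factorial) := by
        congr with n
        rw [Complex.real_smul]
        push_cast
        rw [mul_pow]
        ring
    _ = (Real.exp (-r) : ℂ) * Complex.exp (r * φ) := by
        rw [tsum_mul_left, (NormedSpace.expSeries_div_hasSum_exp (r * φ)).tsum_eq,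
          Complex.exp_eq_exp_ℂ]
    _ = Complex.exp (r * (φ - 1)) := by
        rw [Complex.ofReal_exp, ← Complex.exp_add]
        push_cast
        ring_nf

/-- The annuli are independent and partition the line, so their exponents add up to one integral.
Allowing measurable `f` lets this apply to step functions. -/
lemma charFunctional_map_ofMarks {f : ℝ → ℝ} (hf : Measurable f) {K : ℕ}
    (hK : ∀ x, (K : ℝ) ≤ |x| → f x = 0)
    (hm : Measurable fun ξ : Conf ℝ => ∫ x, f x ∂ξ.toMeasure) :
    charFunctional ((markLaw ν).map ofMarks) f =
      Complex.exp (∫ x, (Complex.exp (f x * Complex.I) - 1) ∂ν) := by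
  rw [charFunctional, integral_map measurable_ofMarks.aemeasurable
    (by fun_prop : Measurable fun ξ : Conf ℝ =>
      Complex.exp ((∫ x, f x ∂ξ.toMeasure : ℝ) * Complex.I)).aestronglyMeasurable]
  have e (ω : Marks) : Complex.exp ((∫ x, f x ∂(ofMarks ω).toMeasure : ℝ) * Complex.I) =
      ∏ k ∈ Finset.range K, (fun q => Complex.exp (annulusSum f k q * Complex.I)) (ω k) := by
    rw [← Complex.exp_sum, integral_ofMarks hK]
    push_cast
    rw [Finset.sum_mul]
  simp only [e]
  have hS := measurable_annulusSum hf
  rw [markLaw, integral_prod_range_of_iIndepFun (X := fun k (ω : Marks) => ω k)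
    (f := fun k q => Complex.exp (annulusSum f k q * Complex.I))
    (iIndepFun_infinitePi (X := fun _ => id) fun _ => measurable_id)
    (fun k => measurable_pi_apply k) (fun k => by have := hS k; fun_prop)]
  have e2 (k : ℕ) : ∫ ω : Marks, Complex.exp (annulusSum f k (ω k) * Complex.I)
      ∂Measure.infinitePi (annulusLaw ν) =
      Complex.exp (∫ x, (Complex.exp ((annulus k).indicator f x * Complex.I) - 1) ∂ν) := by
    rw [← integral_exp_annulusSum ν hf k, ← Measure.infinitePi_map_eval (annulusLaw ν) k,
      integral_map (measurable_pi_apply k).aemeasurable (by have := hS k; fun_prop)]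
  simp only [e2]
  rw [← Complex.exp_sum, ← integral_finsetSum _ fun k _ => integrable_exp_indicator_sub_one ν hf k]
  congr 2 with x
  by_cases hx : (K : ℝ) ≤ |x|
  · rw [hK x hx]
    simp only [Complex.ofReal_zero, zero_mul, Complex.exp_zero, sub_self]
    refine Finset.sum_eq_zero fun k _ => ?_
    by_cases hk : x ∈ annulus k
    · simp [hk, hK x hx]
    · simp [hk]
  · have hlt : ⌊|x|⌋₊ < K := (Nat.floor_lt (abs_nonneg _)).2 (not_le.1 hx)
    rw [Finset.sum_eq_single ⌊|x|⌋₊]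
    · rw [Set.indicator_of_mem (show x ∈ annulus ⌊|x|⌋₊ from rfl)]
    · intro k _ hk
      rw [Set.indicator_of_notMem fun hx : x ∈ annulus k => hk hx.symm]
      simp
    · simp [hlt]

/-- A Poisson point process with a given locally finite intensity exists. -/
theorem exists_isPoissonLaw :
    ∃ P : ProbabilityMeasure (Conf ℝ), IsPoissonLaw ν (P : Measure (Conf ℝ)) := by
  have := Measure.isProbabilityMeasure_map (μ := markLaw ν) measurable_ofMarks.aemeasurable
  refine ⟨⟨(markLaw ν).map ofMarks, this⟩,
    isPoissonLaw_of_charFunctional_step (P := (markLaw ν).map ofMarks) ?_⟩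
  intro k Δ y hΔ hc _
  have hcU : IsCompact (⋃ i, closure (Δ i)) := isCompact_iUnion hc
  obtain ⟨r, hr⟩ := hcU.isBounded.subset_closedBall 0
  obtain ⟨K, hK⟩ := exists_nat_gt r
  refine charFunctional_map_ofMarks ν (K := K) ?_ (fun x hx => ?_) ?_
  · exact Finset.measurable_sum _ fun i _ => measurable_const.indicator (hΔ i)
  · refine Finset.sum_eq_zero fun i _ => Set.indicator_of_notMem (fun hi => ?_) _
    have := hr (Set.mem_iUnion.2 ⟨i, subset_closure hi⟩)
    rw [mem_closedBall_zero_iff, Real.norm_eq_abs] at this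
    linarith
  · simp only [integral_step hΔ hc]
    exact Finset.measurable_sum _ fun i _ => (measurable_measureReal (hΔ i)).const_mul _

end Law

end Conf

/-! ### Product estimates and convergence of intensities. -/

lemma norm_prod_range_sub_prod_range_le {a b : ℕ → ℂ} (ha : ∀ n, ‖a n‖ ≤ 1) (hb : ∀ n, ‖b n‖ ≤ 1)
    (N : ℕ) : ‖∏ n ∈ Finset.range N, a n - ∏ n ∈ Finset.range N, b n‖ ≤
      ∑ n ∈ Finset.range N, ‖a n - b n‖ := by
  induction N with
  | zero => simp
  | succ N ih =>
    rw [Finset.prod_range_succ, Finset.prod_range_succ, Finset.sum_range_succ]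
    have hpa : ‖∏ n ∈ Finset.range N, a n‖ ≤ 1 := by
      rw [norm_prod]
      exact Finset.prod_le_one (fun _ _ => norm_nonneg _) fun n _ => ha n
    have e : (∏ n ∈ Finset.range N, a n) * a N - (∏ n ∈ Finset.range N, b n) * b N =
        (∏ n ∈ Finset.range N, a n - ∏ n ∈ Finset.range N, b n) * b N +
          (∏ n ∈ Finset.range N, a n) * (a N - b N) := by ring
    rw [e]
    refine (norm_add_le _ _).trans (add_le_add ?_ ?_)
    · rw [norm_mul]
      exact (mul_le_of_le_one_right (norm_nonneg _) (hb N)).trans ih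
    · rw [norm_mul]
      exact mul_le_of_le_one_left (norm_nonneg _) hpa

lemma integrable_of_bound_of_compact {E : Type*} [NormedAddCommGroup E] {m : Measure ℝ} {K : Set ℝ}
    (hK : IsCompact K) (hmK : m K < ∞) {g : ℝ → E} (hg : AEStronglyMeasurable g m) {C : ℝ}
    (hC : ∀ x, ‖g x‖ ≤ C) (h0 : ∀ x ∉ K, g x = 0) : Integrable g m := by
  refine Integrable.mono' (g := K.indicator fun _ => C)
    ((integrable_indicator_iff hK.measurableSet).2 (integrableOn_const hmK.ne)) hg
    (ae_of_all _ fun x => ?_)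
  by_cases hx : x ∈ K
  · simpa [hx] using hC x
  · simp [hx, h0 x hx]

lemma norm_exp_mul_I_sub_one_le_two (t : ℝ) : ‖Complex.exp (t * Complex.I) - 1‖ ≤ 2 := by
  refine (norm_sub_le _ _).trans ?_
  rw [Complex.norm_exp_ofReal_mul_I, norm_one]
  norm_num

section Intensity

variable {ι : Type*} {L : Filter ι} {m : ι → Measure ℝ} {ν : Measure ℝ}

lemma tendsto_measure_of_tendsto_lintegral
    (h : ∀ f : ℝ → ℝ, Measurable f → HasCompactSupport f → (∀ x, f x ∈ Set.Ico (0 : ℝ) 1) →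
      Tendsto (fun i => ∫⁻ x, ENNReal.ofReal (f x) ∂m i) L (𝓝 (∫⁻ x, ENNReal.ofReal (f x) ∂ν)))
    {K : Set ℝ} (hK : IsCompact K) :
    Tendsto (fun i => m i K) L (𝓝 (ν K)) := by
  -- Test functions must stay below one, so the indicator is halved.
  have h1 := h (K.indicator fun _ => 1 / 2) (measurable_const.indicator hK.measurableSet)
    (HasCompactSupport.intro hK fun x hx => Set.indicator_of_notMem hx _) fun x => by
      by_cases hx : x ∈ K
      · simp only [hx, Set.indicator_of_mem]; norm_num
      · simp [hx]
  have e (m : Measure ℝ) : ∫⁻ x, ENNReal.ofReal (K.indicator (fun _ => (1 / 2 : ℝ)) x) ∂m =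
      2⁻¹ * m K := by
    rw [← lintegral_indicator_const hK.measurableSet]
    congr with x
    by_cases hx : x ∈ K
    · simp only [hx, Set.indicator_of_mem, one_div]
      rw [ENNReal.ofReal_inv_of_pos two_pos]
      simp
    · simp [hx]
  simp only [e] at h1
  have h2 := ENNReal.Tendsto.const_mul h1 (Or.inr (ENNReal.ofNat_ne_top (n := 2)))
  simpa only [← mul_assoc, ENNReal.mul_inv_cancel two_ne_zero ENNReal.ofNat_ne_top, one_mul] using h2

lemma tendsto_integral_of_tendsto_lintegral [IsLocallyFiniteMeasure ν]
    (h : ∀ f : ℝ → ℝ, Measurable f → HasCompactSupport f → (∀ x, f x ∈ Set.Ico (0 : ℝ) 1) →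
      Tendsto (fun i => ∫⁻ x, ENNReal.ofReal (f x) ∂m i) L (𝓝 (∫⁻ x, ENNReal.ofReal (f x) ∂ν)))
    {K : Set ℝ} (hK : IsCompact K) {g : ℝ → ℝ}
    (hg : Measurable g) {C : ℝ} (hC : ∀ x, |g x| ≤ C) (h0 : ∀ x ∉ K, g x = 0) :
    Tendsto (fun i => ∫ x, g x ∂m i) L (𝓝 (∫ x, g x ∂ν)) := by
  have hC0 : 0 ≤ C := (abs_nonneg _).trans (hC 0)
  -- On `K` the sum lies in `[0, 2C]`, so dividing by `2C + 1` gives an admissible test function;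
  -- `g` is recovered by subtracting the mass of `K`.
  let k : ℝ → ℝ := fun x => (2 * C + 1)⁻¹ * (g x + K.indicator (fun _ => C) x)
  have hkm : Measurable k := by
    have : Measurable (K.indicator fun _ : ℝ => C) := measurable_const.indicator hK.measurableSet
    fun_prop
  have hk0 : ∀ x ∉ K, k x = 0 := fun x hx => by simp [k, hx, h0 x hx]
  have hk01 : ∀ x, k x ∈ Set.Ico (0 : ℝ) 1 := by
    intro x
    by_cases hx : x ∈ K
    · have := abs_le.1 (hC x)
      simp only [k, hx, Set.indicator_of_mem]
      refine ⟨mul_nonneg (by positivity) (by linarith), ?_⟩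
      rw [inv_mul_lt_iff₀ (by positivity)]
      linarith
    · rw [hk0 x hx]
      simp
  have hK' := tendsto_measure_of_tendsto_lintegral h hK
  have hνK : ν K < ∞ := hK.measure_lt_top
  have hfin (m : Measure ℝ) (hm : m K < ∞) :
      ∫ x, g x ∂m = (2 * C + 1) * (∫⁻ x, ENNReal.ofReal (k x) ∂m).toReal - C * (m K).toReal := by
    rw [← integral_eq_lintegral_of_nonneg_ae (ae_of_all _ fun x => (hk01 x).1)
      hkm.aestronglyMeasurable, integral_const_mul, ← mul_assoc,
      mul_inv_cancel₀ (by positivity), one_mul, integral_add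
      (integrable_of_bound_of_compact hK hm hg.aestronglyMeasurable hC h0)
      ((integrable_indicator_iff hK.measurableSet).2 (integrableOn_const hm.ne)),
      integral_indicator_const _ hK.measurableSet, smul_eq_mul, measureReal_def]
    ring
  rw [hfin ν hνK]
  have hne : ∫⁻ x, ENNReal.ofReal (k x) ∂ν ≠ ∞ := by
    have := (integrable_of_bound_of_compact hK hνK hkm.aestronglyMeasurable (C := 1) (fun x => by
      rw [Real.norm_eq_abs, abs_of_nonneg (hk01 x).1]; exact (hk01 x).2.le) hk0)
    rw [← lt_top_iff_ne_top]
    exact (hasFiniteIntegral_iff_ofReal (ae_of_all _ fun x => (hk01 x).1)).1 this.2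
  have hlim := (((ENNReal.tendsto_toReal hne).comp
    (h k hkm (HasCompactSupport.intro hK hk0) hk01)).const_mul (2 * C + 1)).sub
    (((ENNReal.tendsto_toReal hνK.ne).comp hK').const_mul C)
  refine hlim.congr' ?_
  -- Splitting the Bochner integral requires `m i K` finite, which holds eventually because the
  -- limit is finite.
  filter_upwards [hK'.eventually (gt_mem_nhds hνK)] with i hi
  exact (hfin (m i) hi).symm

lemma tendsto_integral_exp_sub_one [IsLocallyFiniteMeasure ν]
    (h : ∀ f : ℝ → ℝ, Measurable f → HasCompactSupport f → (∀ x, f x ∈ Set.Ico (0 : ℝ) 1) →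
      Tendsto (fun i => ∫⁻ x, ENNReal.ofReal (f x) ∂m i) L (𝓝 (∫⁻ x, ENNReal.ofReal (f x) ∂ν)))
    (f : C_c(ℝ, ℝ)) :
    Tendsto (fun i => ∫ x, (Complex.exp (f x * Complex.I) - 1) ∂m i) L
      (𝓝 (∫ x, (Complex.exp (f x * Complex.I) - 1) ∂ν)) := by
  set G : ℝ → ℂ := fun x => Complex.exp (f x * Complex.I) - 1 with hG
  have hGm : Measurable G := by
    have := f.continuous.measurable
    fun_prop
  have hK := f.hasCompactSupport.isCompact
  have hG2 (x : ℝ) : ‖G x‖ ≤ 2 := norm_exp_mul_I_sub_one_le_two _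
  have hG0 : ∀ x ∉ tsupport f, G x = 0 := fun x hx => by
    simp [hG, image_eq_zero_of_notMem_tsupport hx]
  have hfin (m : Measure ℝ) (hm : m (tsupport f) < ∞) :
      ∫ x, G x ∂m = (∫ x, (G x).re ∂m : ℝ) + (∫ x, (G x).im ∂m : ℝ) * Complex.I :=
    (integral_re_add_im
      (integrable_of_bound_of_compact hK hm hGm.aestronglyMeasurable hG2 hG0)).symm
  have hνK : ν (tsupport f) < ∞ := hK.measure_lt_top
  have hre := tendsto_integral_of_tendsto_lintegral h hK (g := fun x => (G x).re) (by fun_prop)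
    (fun x => (Complex.abs_re_le_norm _).trans (hG2 x)) fun x hx => by simp [hG0 x hx]
  have him := tendsto_integral_of_tendsto_lintegral h hK (g := fun x => (G x).im) (by fun_prop)
    (fun x => (Complex.abs_im_le_norm _).trans (hG2 x)) fun x hx => by simp [hG0 x hx]
  rw [hfin ν hνK]
  have hlim := ((Complex.continuous_ofReal.tendsto _).comp hre).add
    (((Complex.continuous_ofReal.tendsto _).comp him).mul_const Complex.I)
  refine hlim.congr' ?_
  filter_upwards [(tendsto_measure_of_tendsto_lintegral h hK).eventually (gt_mem_nhds hνK)]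
    with i hi
  exact (hfin (m i) hi).symm

end Intensity

/-! ### Poisson approximation of independent rare points. -/

namespace Conf

variable {Ω : Type*} [MeasurableSpace Ω] {μ : Measure Ω} {X : ℕ → Ω → ℝ} {𝒳 : Ω → Conf ℝ}

/-- The integral of a test function against a configuration with given points. -/
lemma hasSum_integral {ξ : Conf ℝ} {x : ℕ → ℝ}
    (h : ξ.toMeasure = Measure.sum fun n => Measure.dirac (x n)) (f : C_c(ℝ, ℝ)) :
    HasSum (fun n => f (x n)) (∫ y, f y ∂ξ.toMeasure) := by
  have h' : ξ.toMeasure = Measure.sum fun n => (1 : ℝ≥0∞) • Measure.dirac (x n) := by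
    simpa only [one_smul] using h
  have hi : Integrable f ξ.toMeasure := f.integrable
  rw [h', integrable_sum_dirac_iff fun _ => ENNReal.one_ne_top] at hi
  rw [h']
  simpa using hasSum_integral_sum_dirac (fun _ => ENNReal.one_ne_top) hi

/-- Convergence of the characteristic functionals of the first points of a point process. -/
lemma tendsto_prod_charFunctional [IsProbabilityMeasure μ] (hX : ∀ n, Measurable (X n))
    (hi : iIndepFun X μ) (h𝒳 : IsPointProcessOf 𝒳 X μ) (f : C_c(ℝ, ℝ)) :
    Tendsto (fun N => ∏ n ∈ Finset.range N, ∫ ω, Complex.exp (f (X n ω) * Complex.I) ∂μ) atTop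
      (𝓝 (charFunctional (μ.map 𝒳) f)) := by
  have hfm := f.continuous.measurable
  have hm := measurable_integral f
  rw [charFunctional, integral_map h𝒳.measurable.aemeasurable
    (by fun_prop : Measurable fun ξ : Conf ℝ =>
      Complex.exp ((∫ x, f x ∂ξ.toMeasure : ℝ) * Complex.I)).aestronglyMeasurable]
  have e (N : ℕ) : ∏ n ∈ Finset.range N, ∫ ω, Complex.exp (f (X n ω) * Complex.I) ∂μ =
      ∫ ω, Complex.exp ((∑ n ∈ Finset.range N, f (X n ω) : ℝ) * Complex.I) ∂μ := by
    rw [← integral_prod_range_of_iIndepFun hi hX (f := fun _ x => Complex.exp (f x * Complex.I))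
      (fun _ => by fun_prop)]
    congr with ω
    rw [← Complex.exp_sum]
    push_cast
    rw [Finset.sum_mul]
  simp only [e]
  refine tendsto_integral_of_dominated_convergence (fun _ => 1) (fun N => ?_)
    (integrable_const _) (fun N => ae_of_all _ fun ω => ?_) ?_
  · have : Measurable fun ω => ∑ n ∈ Finset.range N, f (X n ω) :=
      Finset.measurable_sum _ fun n _ => hfm.comp (hX n)
    fun_prop
  · rw [Complex.norm_exp_ofReal_mul_I]
  · filter_upwards [h𝒳.ae_eq] with ω hω
    have : Continuous fun t : ℝ => Complex.exp (t * Complex.I) := by fun_prop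
    exact (this.tendsto _).comp (hasSum_integral hω f).tendsto_sum_nat

/-- The characteristic functional of a point process with independent, individually rare points is
close to that of a Poisson point process with the same intensity. -/
lemma norm_charFunctional_sub_le [IsProbabilityMeasure μ] (hX : ∀ n, Measurable (X n))
    (hi : iIndepFun X μ) (h𝒳 : IsPointProcessOf 𝒳 X μ) (f : C_c(ℝ, ℝ)) {s : ℝ} (hs : s ≤ 1 / 2)
    (hp : ∀ n, μ.real {ω | X n ω ∈ tsupport f} ≤ s)
    (hm : (Measure.sum fun n => μ.map (X n)) (tsupport f) < ∞) :
    ‖charFunctional (μ.map 𝒳) f -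
      Complex.exp (∫ x, (Complex.exp (f x * Complex.I) - 1) ∂Measure.sum fun n => μ.map (X n))‖ ≤
      4 * s * (Measure.sum fun n => μ.map (X n)).real (tsupport f) := by
  set M := Measure.sum fun n => μ.map (X n) with hM
  set K := tsupport f with hKdef
  have hK : IsCompact K := f.hasCompactSupport.isCompact
  have hfm := f.continuous.measurable
  let z : ℕ → ℂ := fun n => ∫ x, (Complex.exp (f x * Complex.I) - 1) ∂μ.map (X n)
  let φ : ℕ → ℂ := fun n => ∫ ω, Complex.exp (f (X n ω) * Complex.I) ∂μ
  let p : ℕ → ℝ := fun n => μ.real {ω | X n ω ∈ K}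
  have hpX (n : ℕ) : p n = (μ.map (X n)).real K := by
    rw [map_measureReal_apply (hX n) hK.measurableSet]
    rfl
  have hps : HasSum p (M.real K) := by
    have h1 : M K = ∑' n, μ.map (X n) K := Measure.sum_apply _ hK.measurableSet
    simp only [funext hpX, measureReal_def, h1]
    rw [h1] at hm
    rw [ENNReal.tsum_toReal_eq (ENNReal.ne_top_of_tsum_ne_top hm.ne)]
    exact ENNReal.hasSum_toReal hm.ne
  have hzs : HasSum z (∫ x, (Complex.exp (f x * Complex.I) - 1) ∂M) :=
    hasSum_integral_measure (integrable_of_bound_of_compact hK hm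
      (by fun_prop) (C := 2) (fun x => norm_exp_mul_I_sub_one_le_two _) fun x hx => by
        simp [image_eq_zero_of_notMem_tsupport hx])
  have hz2 (n : ℕ) : ‖z n‖ ≤ 2 * p n := by
    have hzK : z n = ∫ x in K, (Complex.exp (f x * Complex.I) - 1) ∂μ.map (X n) := by
      refine (setIntegral_eq_integral_of_forall_compl_eq_zero fun x hx => ?_).symm
      simp [image_eq_zero_of_notMem_tsupport hx]
    have := Measure.isProbabilityMeasure_map (μ := μ) (hX n).aemeasurable
    rw [hzK, hpX]
    exact norm_setIntegral_le_of_norm_le_const (measure_lt_top _ _)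
      fun x _ => norm_exp_mul_I_sub_one_le_two _
  have hφ1 (n : ℕ) : ‖φ n‖ ≤ 1 := by
    refine (norm_integral_le_of_norm_le_const (C := 1) (ae_of_all _ fun ω => ?_)).trans ?_
    · rw [Complex.norm_exp_ofReal_mul_I]
    · simp
  have hzφ (n : ℕ) : z n = φ n - 1 := by
    have hXn := hX n
    simp only [z, φ]
    rw [integral_map (hX n).aemeasurable (by fun_prop), integral_sub _ (integrable_const _)]
    · simp
    · refine Integrable.of_bound (by fun_prop) 1 (ae_of_all _ fun ω => ?_)
      rw [Complex.norm_exp_ofReal_mul_I]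
  -- The real part of `z n = φ n - 1` is nonpositive.
  have hez (n : ℕ) : ‖Complex.exp (z n)‖ ≤ 1 := by
    rw [Complex.norm_exp, hzφ, Complex.sub_re, Complex.one_re]
    exact Real.exp_le_one_iff.2 (by linarith [(Complex.re_le_norm (φ n)).trans (hφ1 n)])
  have hp0 (n : ℕ) : 0 ≤ p n := measureReal_nonneg
  have hs0 : 0 ≤ s := (hp0 0).trans (hp 0)
  have hdiff (n : ℕ) : ‖φ n - Complex.exp (z n)‖ ≤ 4 * s * p n := by
    -- This is where `s ≤ 1 / 2` enters: the quadratic bound on `exp z - 1 - z` requires norm at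
    -- most one.
    have h1 : ‖z n‖ ≤ 1 := (hz2 n).trans (by linarith [hp n])
    have h2 := Complex.norm_exp_sub_one_sub_id_le h1
    have h3 : φ n - Complex.exp (z n) = -(Complex.exp (z n) - 1 - z n) := by
      rw [show φ n = z n + 1 by rw [hzφ]; ring]
      ring
    rw [h3, norm_neg]
    calc _ ≤ ‖z n‖ ^ 2 := h2
      _ ≤ (2 * p n) ^ 2 := by gcongr; exact hz2 n
      _ = 4 * p n * p n := by ring
      _ ≤ 4 * s * p n := by
        have := hp0 n
        gcongr
        exact hp n
  have hlim : Tendsto (fun N => ‖∏ n ∈ Finset.range N, φ n -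
      ∏ n ∈ Finset.range N, Complex.exp (z n)‖) atTop
      (𝓝 ‖charFunctional (μ.map 𝒳) f -
        Complex.exp (∫ x, (Complex.exp (f x * Complex.I) - 1) ∂M)‖) := by
    refine ((tendsto_prod_charFunctional hX hi h𝒳 f).sub ?_).norm
    simp only [← Complex.exp_sum]
    exact (Complex.continuous_exp.tendsto _).comp hzs.tendsto_sum_nat
  refine le_of_tendsto' hlim fun N => ?_
  calc _ ≤ ∑ n ∈ Finset.range N, ‖φ n - Complex.exp (z n)‖ :=
        norm_prod_range_sub_prod_range_le hφ1 hez N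
    _ ≤ ∑ n ∈ Finset.range N, 4 * s * p n := Finset.sum_le_sum fun n _ => hdiff n
    _ = 4 * s * ∑ n ∈ Finset.range N, p n := by rw [Finset.mul_sum]
    _ ≤ 4 * s * M.real K := by
      gcongr
      exact sum_le_hasSum _ (fun n _ => hp0 n) hps

end Conf

/-! ### Convergence to the Poisson point process. -/

theorem mainTheorem9
    {Ω : Set.Ioi (0 : ℝ) → Type*} [∀ R, MeasurableSpace (Ω R)]
    (μ : ∀ R, Measure (Ω R)) [∀ R, IsProbabilityMeasure (μ R)]
    (X : ∀ R, ℕ → Ω R → ℝ)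
    (hX_meas : ∀ R n, Measurable (X R n))
    (hX_indep : ∀ R, iIndepFun (X R) (μ R))
    (hX_escape : ∀ K : Set ℝ, IsCompact K →
      Tendsto (fun R => ⨆ n, μ R {ω | X R n ω ∈ K}) atTop (𝓝 0))
    (ν : Measure ℝ) [IsLocallyFiniteMeasure ν]
    (hX_mean : ∀ f : ℝ → ℝ, Measurable f → HasCompactSupport f → (∀ x, f x ∈ Set.Ico (0 : ℝ) 1) →
      Tendsto (fun R => ∑' n, ∫⁻ ω, ENNReal.ofReal (f (X R n ω)) ∂(μ R)) atTop
        (𝓝 (∫⁻ x, ENNReal.ofReal (f x) ∂ν)))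
    (𝒳 : ∀ R, Ω R → Conf ℝ)
    (h𝒳 : ∀ R, IsPointProcessOf (𝒳 R) (X R) (μ R)) :
    (∃ P : ProbabilityMeasure (Conf ℝ), IsPoissonLaw ν (P : Measure (Conf ℝ))) ∧
    ∀ P : ProbabilityMeasure (Conf ℝ), IsPoissonLaw ν (P : Measure (Conf ℝ)) →
      TendstoInDistribution 𝒳 atTop id μ (P : Measure (Conf ℝ)) := by
  refine ⟨Conf.exists_isPoissonLaw ν, fun P hP => ⟨fun R => (h𝒳 R).measurable.aemeasurable,
    aemeasurable_id, Conf.tendsto_of_tendsto_charFunctional fun f => ?_⟩⟩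
  simp only [ProbabilityMeasure.coe_mk, Measure.map_id]
  rw [Conf.charFunctional_of_isPoissonLaw hP f]
  let m : Set.Ioi (0 : ℝ) → Measure ℝ := fun R => Measure.sum fun n => (μ R).map (X R n)
  have hm : ∀ f : ℝ → ℝ, Measurable f → HasCompactSupport f → (∀ x, f x ∈ Set.Ico (0 : ℝ) 1) →
      Tendsto (fun R => ∫⁻ x, ENNReal.ofReal (f x) ∂m R) atTop
        (𝓝 (∫⁻ x, ENNReal.ofReal (f x) ∂ν)) := by
    intro f hf hc h01
    refine (hX_mean f hf hc h01).congr fun R => ?_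
    rw [lintegral_sum_measure]
    exact tsum_congr fun n => (lintegral_map hf.ennreal_ofReal (hX_meas R n)).symm
  have hK : IsCompact (tsupport f) := f.hasCompactSupport.isCompact
  have hνK : ν (tsupport f) < ∞ := hK.measure_lt_top
  have hmK := tendsto_measure_of_tendsto_lintegral hm hK
  have hesc := hX_escape _ hK
  have hexp := (Complex.continuous_exp.tendsto _).comp (tendsto_integral_exp_sub_one hm f)
  have hbound : Tendsto (fun R => 4 * (⨆ n, μ R {ω | X R n ω ∈ tsupport f}).toReal *
      (m R (tsupport f)).toReal) atTop (𝓝 0) := by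
    simpa using (((ENNReal.tendsto_toReal ENNReal.zero_ne_top).comp hesc).const_mul 4).mul
      ((ENNReal.tendsto_toReal hνK.ne).comp hmK)
  have hdiff : Tendsto (fun R => Conf.charFunctional ((μ R).map (𝒳 R)) f -
      Complex.exp (∫ x, (Complex.exp (f x * Complex.I) - 1) ∂m R)) atTop (𝓝 0) := by
    -- The approximation bound holds only eventually: it needs finite intensity on the support and
    -- hitting probabilities of at most `1 / 2`.
    refine squeeze_zero_norm' ?_ hbound
    filter_upwards [hmK.eventually (gt_mem_nhds hνK),
      hesc.eventually (gt_mem_nhds (show (0 : ℝ≥0∞) < ENNReal.ofReal (1 / 2) by norm_num))]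
      with R h1 h2
    refine Conf.norm_charFunctional_sub_le (hX_meas R) (hX_indep R) (h𝒳 R) f
      (ENNReal.toReal_le_of_le_ofReal (by norm_num) h2.le) (fun n => ?_) h1
    exact ENNReal.toReal_mono (h2.trans ENNReal.ofReal_lt_top).ne
      (le_iSup (fun n => μ R {ω | X R n ω ∈ tsupport f}) n)
  simpa using hdiff.add hexp
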